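/- Let $\mathcal L:[0,\infty)\to[1,\infty)$ be nondecreasing with $\mathcal L(0)=1$ and $M:=1+\int_0^\infty\frac{dt}{(t+1)\mathcal L(t)}<\infty$, and assume that $(t+1)\ln\mathcal L(t)$ is convex on $[0,\infty)$. Let $d\ge 1$ be an integer. For $\gamma,\tilde\gamma>0$ let $\mathcal S(d,\mathcal L;\gamma,\tilde\gamma)$ be the set of all $\hat A\in C^\infty[0,\infty)^d$ with $\|\hat A\|_\infty\le\gamma$ and $$\frac1{k!}\|D_j^k\hat A\|_\infty\le\gamma\big(\tilde\gamma\,\mathcal L(k-1)\big)^k\quad\text{for all integers }k\ge1\text{ and all }1\le j\le d,$$ where $D_j^k=\partial^k/\partial t_j^k$ (one-sided at the boundary) and $\|\cdot\|_\infty$ of a function is the supremum over $[0,\infty)^d$. Put $\mathcal B_1:=\{t\in[0,\infty)^d:\ t_1+\dots+t_d\le1\}$ and $\|t\|_\infty:=\max_i|t_i|$, and let $\operatorname{proj}_k t$ be $t$ with its $k$-th coordinate replaced by $0$. A function $\hat A\in C^\infty[0,\infty)^d$ is called admissible of second kind and type $(a)$, $(b)$ or $(c)$ if $\operatorname{supp}\hat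 A\subset[0,2]^d$, if $\hat A(t)=\hat A(\operatorname{proj}_k t)$ for all $1\le k\le d$ and all $t\in[0,\infty)^d$ with $t_k\le\frac12\|t\|_\infty$, and if, respectively, $(a)$ $\hat A(t)=1$ for $t\in\mathcal B_1$; $(b)$ $\hat A(t)=0$ for $t\in\frac12\mathcal B_1$; $(c)$ $\hat A(t)=0$ for $t\in\frac12\mathcal B_1$, and $\sum_{j=0}^\infty|\hat A(2^{-j}t)|^2=1$ for $t\in[0,\infty)^d\setminus[0,1)^d$. Then, for each of the types $(a)$, $(b)$, $(c)$, the set $$\mathcal S\big(d,\mathcal L;\,8,\,10d(2d-1)M(8(d+2)M+1)\big)$$ contains an admissible function $\hat A$ of second kind and of that type, with $0\le\hat A\le1$. -/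

import Mathlib

open Set MeasureTheory
open scoped Pointwise ContDiff

noncomputable section

/-- The conditions on a growth function `L : [0, ∞) → [1, ∞)`: it is nondecreasing, `L 0 = 1`, and
`∫₀^∞ dt / ((t + 1) L(t)) < ∞`. Values of `L` at negative arguments play no role. -/
structure IsGrowthFunction (L : ℝ → ℝ) : Prop where
  one_le : ∀ t, 0 ≤ t → 1 ≤ L t
  monotoneOn : MonotoneOn L (Ici 0)
  map_zero : L 0 = 1
  integrableOn : IntegrableOn (fun t : ℝ => 1 / ((t + 1) * L t)) (Ioi 0)

/-- `M(L) = 1 + ∫₀^∞ dt / ((t + 1) L(t))`. -/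
def growthConst (L : ℝ → ℝ) : ℝ :=
  1 + ∫ t in Ioi (0 : ℝ), 1 / ((t + 1) * L t)

/-- The closed orthant `[0, ∞)^d`. -/
def orthant (d : ℕ) : Set (Fin d → ℝ) :=
  {t | ∀ i, 0 ≤ t i}

/-- `D_j^k A (t)`, the `k`-th partial derivative in the `j`-th variable of a function on `[0, ∞)^d`,
one-sided where `t j = 0`. -/
def partialDeriv {d : ℕ} (j : Fin d) (k : ℕ) (A : (Fin d → ℝ) → ℝ) (t : Fin d → ℝ) : ℝ :=
  iteratedDerivWithin k (fun s : ℝ => A (Function.update t j s)) (Ici 0) (t j)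

/-- The class `S(d, L; γ, γ')` of smooth functions on `[0, ∞)^d` with small derivatives.
Only the values on the orthant matter. -/
def smallDerivClass (d : ℕ) (L : ℝ → ℝ) (γ γ' : ℝ) : Set ((Fin d → ℝ) → ℝ) :=
  {A | ContDiffOn ℝ ∞ A (orthant d) ∧
    (∀ t ∈ orthant d, |A t| ≤ γ) ∧
    ∀ k : ℕ, 1 ≤ k → ∀ j : Fin d, ∀ t ∈ orthant d,
      1 / (k.factorial : ℝ) * |partialDeriv j k A t| ≤ γ * (γ' * L ((k : ℝ) - 1)) ^ k}

/-- `proj_k t`: the `k`-th coordinate is replaced by `0`. -/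
def coordProj {d : ℕ} (k : Fin d) (t : Fin d → ℝ) : Fin d → ℝ :=
  Function.update t k 0

/-- The part `B₁` of the unit ball of the `ℓ¹` norm in the orthant. -/
def ballOne (d : ℕ) : Set (Fin d → ℝ) :=
  {t | t ∈ orthant d ∧ ∑ i, |t i| ≤ 1}

/-- The three types of cutoff functions. -/
inductive CutoffType
  | a
  | b
  | c

/-- The condition defining each type of cutoff function. -/
def HasCutoffType {d : ℕ} (A : (Fin d → ℝ) → ℝ) : CutoffType → Prop
  | .a => ∀ t ∈ ballOne d, A t = 1
  | .b => ∀ t ∈ (1 / 2 : ℝ) • ballOne d, A t = 0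
  | .c => (∀ t ∈ (1 / 2 : ℝ) • ballOne d, A t = 0) ∧
      ∀ t ∈ orthant d \ {t | ∀ i, t i ∈ Ico (0 : ℝ) 1},
        HasSum (fun j : ℕ => |A (((2 : ℝ) ^ j)⁻¹ • t)| ^ 2) 1

/-- Admissible `d`-variate cutoff functions of the second kind, of a given type. The norm on
`Fin d → ℝ` is the maximum norm. -/
structure IsAdmissibleSecondKind {d : ℕ} (τ : CutoffType) (A : (Fin d → ℝ) → ℝ) : Prop where
  contDiffOn : ContDiffOn ℝ ∞ A (orthant d)
  support_subset :
    closure {t | t ∈ orthant d ∧ A t ≠ 0} ⊆ {t | ∀ i, t i ∈ Icc (0 : ℝ) 2}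
  eq_proj : ∀ t ∈ orthant d, ∀ k : Fin d, t k ≤ 1 / 2 * ‖t‖ → A t = A (coordProj k t)
  hasType : HasCutoffType A τ

end

/-!
Averaging a smooth function successively over intervals of widths `a 0, a 1, …` costs a factor
`2 / a i` per derivative, whatever the function was, and spreads its transition region by at most
`∑ a i`. As `∑ 1 / ((n + 1) L(n)) ≤ M`, the widths `a n = 1 / (2 M (n + 1) L(n))` turn a smooth
step into a univariate cutoff `g` with `|g⁽ᵏ⁾| ≤ k! (4 M L(k - 1))ᵏ`. The product
`G(t) = g(t₁) ⋯ g(t_d)` is of type (a). The function `sin (π/2 G(t)) cos (π/2 G(2t))` is of types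
(b) and (c): at each `t` either `G(t) = 1` or `G(2t) = 0`, so its square is
`sin² (π/2 G(t)) - sin² (π/2 G(2t))` and the dyadic sum telescopes. Bounds of the form `k! Rᵏ` are
stable under products, and under `sin` and `cos` because `h = exp (i c f)` solves `h' = i c f' h`.
-/

open Filter Topology
open scoped Nat

/-! ### Box averages -/

section BoxAverage

variable {E : Type*} [NormedAddCommGroup E] [NormedSpace ℝ E]

/-- The average of `f` over the interval `[x - a, x]`, as a function of its right endpoint `x`;
this is the convolution of `f` with the normalized indicator function of `[0, a]`. -/
noncomputable def boxAverage (a : ℝ) (f : ℝ → E) (x : ℝ) : E :=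
  a⁻¹ • ∫ y in (x - a)..x, f y

variable [CompleteSpace E] {a : ℝ} {f : ℝ → E}

theorem hasDerivAt_boxAverage (hf : Continuous f) (x : ℝ) :
    HasDerivAt (boxAverage a f) (a⁻¹ • (f x - f (x - a))) x := by
  have hprim (z : ℝ) : HasDerivAt (fun u => ∫ y in (0 : ℝ)..u, f y) (f z) z :=
    hf.integral_hasStrictDerivAt 0 z |>.hasDerivAt
  have heq : boxAverage a f =
      fun z => a⁻¹ • ((∫ y in (0 : ℝ)..z, f y) - ∫ y in (0 : ℝ)..(z - a), f y) := by
    funext z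
    rw [boxAverage, intervalIntegral.integral_interval_sub_left (hf.intervalIntegrable _ _)
      (hf.intervalIntegrable _ _)]
  rw [heq]
  exact ((hprim x).sub (HasDerivAt.comp_sub_const x a (hprim (x - a)))).const_smul _

theorem deriv_boxAverage (hf : ContDiff ℝ 1 f) :
    deriv (boxAverage a f) = boxAverage a (deriv f) := by
  funext x
  rw [(hasDerivAt_boxAverage hf.continuous x).deriv, boxAverage,
    intervalIntegral.integral_deriv_eq_sub (fun y _ => hf.differentiable one_ne_zero y)
      (hf.continuous_deriv_one.intervalIntegrable _ _)]

theorem contDiff_boxAverage (hf : ContDiff ℝ ∞ f) : ContDiff ℝ ∞ (boxAverage a f) := by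
  refine contDiff_infty_iff_deriv.2
    ⟨fun x => (hasDerivAt_boxAverage hf.continuous x).differentiableAt, ?_⟩
  have hderiv : deriv (boxAverage a f) = fun x => a⁻¹ • (f x - f (x - a)) :=
    funext fun x => (hasDerivAt_boxAverage hf.continuous x).deriv
  rw [hderiv]
  fun_prop

theorem iteratedDeriv_boxAverage {k : ℕ} (hf : ContDiff ℝ k f) :
    iteratedDeriv k (boxAverage a f) = boxAverage a (iteratedDeriv k f) := by
  induction k generalizing f with
  | zero => simp only [iteratedDeriv_zero]
  | succ k ih =>
    rw [Nat.cast_succ] at hf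
    rw [iteratedDeriv_succ', deriv_boxAverage (hf.of_le le_add_self), ih hf.deriv',
      iteratedDeriv_succ']

theorem boxAverage_mem {K : Set E} (hK : Convex ℝ K) (hKc : IsClosed K) (ha : 0 < a)
    (hf : Continuous f) {x : ℝ} (hfK : MapsTo f (Icc (x - a) x) K) : boxAverage a f x ∈ K := by
  have hle : x - a ≤ x := by linarith
  have heq : boxAverage a f x = ⨍ y in Ioc (x - a) x, f y := by
    rw [boxAverage, ← uIoc_of_le hle, interval_average_eq, sub_sub_cancel]
  rw [heq]
  refine hK.set_average_mem hKc (by simp [ha]) (by simp) ?_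
    (hf.integrableOn_Icc.mono_set Ioc_subset_Icc_self)
  exact ae_restrict_of_forall_mem measurableSet_Ioc fun y hy => hfK (Ioc_subset_Icc_self hy)

theorem norm_boxAverage_le (ha : 0 < a) (hf : Continuous f) {C : ℝ} (hC : ∀ y, ‖f y‖ ≤ C)
    (x : ℝ) : ‖boxAverage a f x‖ ≤ C :=
  mem_closedBall_zero_iff.1 <| boxAverage_mem (convex_closedBall 0 C) Metric.isClosed_closedBall ha
    hf fun y _ => mem_closedBall_zero_iff.2 (hC y)

theorem norm_deriv_boxAverage_le (ha : 0 < a) (hf : Continuous f) {C : ℝ} (hC : ∀ y, ‖f y‖ ≤ C)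
    (x : ℝ) : ‖deriv (boxAverage a f) x‖ ≤ C * (2 / a) := by
  rw [(hasDerivAt_boxAverage hf x).deriv, norm_smul, Real.norm_of_nonneg (inv_nonneg.2 ha.le)]
  calc a⁻¹ * ‖f x - f (x - a)‖ ≤ a⁻¹ * (C + C) := by gcongr; exact norm_sub_le_of_le (hC _) (hC _)
    _ = C * (2 / a) := by ring

theorem norm_boxAverage_sub_le (ha : 0 < a) (hf : Differentiable ℝ f) {C : ℝ}
    (hC : ∀ y, ‖deriv f y‖ ≤ C) (x : ℝ) : ‖boxAverage a f x - f x‖ ≤ a * C := by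
  rw [← mem_closedBall_iff_norm]
  refine boxAverage_mem (convex_closedBall _ _) Metric.isClosed_closedBall ha hf.continuous
    fun y hy => mem_closedBall_iff_norm.2 ?_
  have hC0 : 0 ≤ C := (norm_nonneg _).trans (hC x)
  have hxy : ‖y - x‖ ≤ a := abs_le.2 ⟨by linarith [hy.1], by linarith [hy.2]⟩
  calc ‖f y - f x‖ ≤ C * ‖y - x‖ :=
        convex_univ.norm_image_sub_le_of_norm_deriv_le (fun z _ => hf z) (fun z _ => hC z)
          (mem_univ x) (mem_univ y)
    _ ≤ C * a := by gcongr
    _ = a * C := mul_comm C a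

/-- The function `f` averaged successively over boxes of widths `a 0, …, a (n - 1)`. -/
noncomputable def iteratedBoxAverage (a : ℕ → ℝ) (f : ℝ → E) : ℕ → ℝ → E
  | 0 => f
  | n + 1 => boxAverage (a n) (iteratedBoxAverage a f n)

end BoxAverage

section IteratedBoxAverage

variable {E : Type*} [NormedAddCommGroup E] [NormedSpace ℝ E] [CompleteSpace E]
  {a : ℕ → ℝ} {f : ℝ → E}

theorem contDiff_iteratedBoxAverage (a : ℕ → ℝ) (hf : ContDiff ℝ ∞ f) (n : ℕ) :
    ContDiff ℝ ∞ (iteratedBoxAverage a f n) := by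
  induction n with
  | zero => exact hf
  | succ n ih => exact contDiff_boxAverage ih

theorem iteratedDeriv_iteratedBoxAverage_succ (a : ℕ → ℝ) (hf : ContDiff ℝ ∞ f) (n k : ℕ) :
    iteratedDeriv k (iteratedBoxAverage a f (n + 1)) =
      boxAverage (a n) (iteratedDeriv k (iteratedBoxAverage a f n)) :=
  iteratedDeriv_boxAverage ((contDiff_iteratedBoxAverage a hf n).of_le (mod_cast le_top))

theorem continuous_iteratedDeriv_iteratedBoxAverage (a : ℕ → ℝ) (hf : ContDiff ℝ ∞ f) (n k : ℕ) :
    Continuous (iteratedDeriv k (iteratedBoxAverage a f n)) :=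
  (contDiff_iteratedBoxAverage a hf n).continuous_iteratedDeriv k (mod_cast le_top)

theorem iteratedBoxAverage_mem {K : Set E} (hK : Convex ℝ K) (hKc : IsClosed K)
    (ha : ∀ n, 0 < a n) (hf : ContDiff ℝ ∞ f) {n : ℕ} {x : ℝ}
    (hfK : MapsTo f (Icc (x - ∑ i ∈ Finset.range n, a i) x) K) :
    iteratedBoxAverage a f n x ∈ K := by
  induction n generalizing x with
  | zero => exact hfK (by simp)
  | succ n ih =>
    refine boxAverage_mem hK hKc (ha n) (contDiff_iteratedBoxAverage a hf n).continuous
      fun y hy => ih (hfK.mono_left (Icc_subset_Icc ?_ hy.2))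
    rw [Finset.sum_range_succ]
    linarith [hy.1]

theorem norm_iteratedDeriv_iteratedBoxAverage_le (ha : ∀ n, 0 < a n) (hf : ContDiff ℝ ∞ f)
    {k : ℕ} {C : ℝ} (hC : ∀ x, ‖iteratedDeriv k f x‖ ≤ C) (n : ℕ) (x : ℝ) :
    ‖iteratedDeriv k (iteratedBoxAverage a f n) x‖ ≤ C := by
  induction n generalizing x with
  | zero => exact hC x
  | succ n ih =>
    rw [iteratedDeriv_iteratedBoxAverage_succ a hf]
    exact norm_boxAverage_le (ha n) (continuous_iteratedDeriv_iteratedBoxAverage a hf n k) ih x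

/-- Each of the first `k` averages absorbs one of the `k` derivatives, at the cost of a factor
`2 / a i`; the later averages do not increase the supremum. -/
theorem norm_iteratedDeriv_iteratedBoxAverage_le_prod (ha : ∀ n, 0 < a n) (hf : ContDiff ℝ ∞ f)
    {C : ℝ} (hC : ∀ x, ‖f x‖ ≤ C) {k n : ℕ} (hkn : k ≤ n) (x : ℝ) :
    ‖iteratedDeriv k (iteratedBoxAverage a f n) x‖ ≤ C * ∏ i ∈ Finset.range k, (2 / a i) := by
  induction n generalizing k x with
  | zero =>
    obtain rfl : k = 0 := Nat.le_zero.1 hkn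
    simpa [iteratedBoxAverage] using hC x
  | succ n ih =>
    have hcont := continuous_iteratedDeriv_iteratedBoxAverage a hf n
    rcases Nat.le_succ_iff.1 hkn with h | rfl
    · rw [iteratedDeriv_iteratedBoxAverage_succ a hf]
      exact norm_boxAverage_le (ha n) (hcont k) (fun y => ih h y) x
    · rw [iteratedDeriv_succ, iteratedDeriv_iteratedBoxAverage_succ a hf, Finset.prod_range_succ,
        ← mul_assoc]
      exact norm_deriv_boxAverage_le (ha n) (hcont n) (fun y => ih le_rfl y) x

theorem norm_iteratedDeriv_iteratedBoxAverage_succ_sub_le (ha : ∀ n, 0 < a n)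
    (hf : ContDiff ℝ ∞ f) {k : ℕ} {C : ℝ} (hC : ∀ x, ‖iteratedDeriv (k + 1) f x‖ ≤ C)
    (n : ℕ) (x : ℝ) :
    ‖iteratedDeriv k (iteratedBoxAverage a f (n + 1)) x -
      iteratedDeriv k (iteratedBoxAverage a f n) x‖ ≤ a n * C := by
  rw [iteratedDeriv_iteratedBoxAverage_succ a hf]
  have hdiff : Differentiable ℝ (iteratedDeriv k (iteratedBoxAverage a f n)) :=
    (contDiff_iteratedBoxAverage a hf n).differentiable_iteratedDeriv k
      (mod_cast WithTop.coe_lt_top _)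
  refine norm_boxAverage_sub_le (ha n) hdiff (fun y => ?_) x
  rw [← iteratedDeriv_succ]
  exact norm_iteratedDeriv_iteratedBoxAverage_le ha hf hC n y

end IteratedBoxAverage

theorem exists_contDiff_tendsto_iteratedFDeriv {𝕜 E F : Type*} [RCLike 𝕜] [NormedAddCommGroup E]
    [NormedSpace 𝕜 E] [NormedAddCommGroup F] [NormedSpace 𝕜 F] [CompleteSpace F]
    {f : ℕ → E → F} (hf : ∀ n, ContDiff 𝕜 ∞ (f n)) {v : ℕ → ℕ → ℝ} (hv : ∀ k, Summable (v k))
    (hfv : ∀ k n x, ‖iteratedFDeriv 𝕜 k (f (n + 1)) x - iteratedFDeriv 𝕜 k (f n) x‖ ≤ v k n) :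
    ∃ g : E → F, ContDiff 𝕜 ∞ g ∧
      ∀ k x, Tendsto (fun n => iteratedFDeriv 𝕜 k (f n) x) atTop (𝓝 (iteratedFDeriv 𝕜 k g x)) := by
  have hfk (n k : ℕ) : ContDiff 𝕜 k (f n) := (hf n).of_le (mod_cast le_top)
  have hsub (k n : ℕ) : iteratedFDeriv 𝕜 k (fun y => f (n + 1) y - f n y) =
      fun x => iteratedFDeriv 𝕜 k (f (n + 1)) x - iteratedFDeriv 𝕜 k (f n) x :=
    fun_iteratedFDeriv_sub (hfk (n + 1) k) (hfk n k)
  have hdiff (n : ℕ) : ContDiff 𝕜 ((⊤ : ℕ∞) : ℕ∞ω) fun y => f (n + 1) y - f n y :=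
    (hf _).sub (hf _)
  have hdiffv (k n : ℕ) (x : E) (_ : (k : ℕ∞) ≤ ⊤) :
      ‖iteratedFDeriv 𝕜 k (fun y => f (n + 1) y - f n y) x‖ ≤ v k n := by
    rw [hsub]
    exact hfv k n x
  have hseries := contDiff_tsum hdiff (fun k _ => hv k) hdiffv
  refine ⟨fun x => f 0 x + ∑' n, (f (n + 1) x - f n x), (hf 0).add hseries, fun k x => ?_⟩
  rw [fun_iteratedFDeriv_add_apply (hfk 0 k).contDiffAt
    (hseries.contDiffAt.of_le (mod_cast le_top)),
    iteratedFDeriv_tsum_apply hdiff (fun k _ => hv k) hdiffv le_top]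
  simp only [hsub]
  have hsum : Summable fun n => iteratedFDeriv 𝕜 k (f (n + 1)) x - iteratedFDeriv 𝕜 k (f n) x :=
    .of_norm_bounded (hv k) fun n => hfv k n x
  refine (hsum.hasSum.tendsto_sum_nat.const_add _).congr fun n => ?_
  rw [Finset.sum_range_sub fun n => iteratedFDeriv 𝕜 k (f n) x, add_sub_cancel]

theorem exists_contDiff_norm_iteratedDeriv_le_prod {E : Type*} [NormedAddCommGroup E]
    [NormedSpace ℝ E] [CompleteSpace E] {a : ℕ → ℝ} (ha : ∀ n, 0 < a n) (hsum : Summable a)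
    {f : ℝ → E} (hf : ContDiff ℝ ∞ f)
    (hbdd : ∀ k : ℕ, ∃ C, ∀ x, ‖iteratedDeriv (k + 1) f x‖ ≤ C) {C : ℝ} (hC : ∀ x, ‖f x‖ ≤ C) :
    ∃ g : ℝ → E, ContDiff ℝ ∞ g ∧
      (∀ K : Set E, Convex ℝ K → IsClosed K → ∀ x, MapsTo f (Icc (x - ∑' i, a i) x) K → g x ∈ K) ∧
      ∀ k x, ‖iteratedDeriv k g x‖ ≤ C * ∏ i ∈ Finset.range k, (2 / a i) := by
  choose D hD using hbdd
  have hsmooth (n k : ℕ) {x : ℝ} : ContDiffAt ℝ k (iteratedBoxAverage a f n) x :=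
    (contDiff_iteratedBoxAverage a hf n).contDiffAt.of_le (mod_cast le_top)
  obtain ⟨g, hg, hlim⟩ := exists_contDiff_tendsto_iteratedFDeriv (𝕜 := ℝ)
    (contDiff_iteratedBoxAverage a hf) (v := fun k n => a n * D k)
    (fun k => hsum.mul_right (D k)) fun k n x => by
      rw [← fun_iteratedFDeriv_sub_apply (hsmooth (n + 1) k) (hsmooth n k),
        norm_iteratedFDeriv_eq_norm_iteratedDeriv,
        iteratedDeriv_fun_sub (hsmooth (n + 1) k) (hsmooth n k)]
      exact norm_iteratedDeriv_iteratedBoxAverage_succ_sub_le ha hf (hD k) n x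
  refine ⟨g, hg, fun K hK hKc x hfK => ?_, fun k x => ?_⟩
  · have hlim0 : Tendsto (fun n => iteratedBoxAverage a f n x) atTop (𝓝 (g x)) := by
      simpa [Function.comp_def] using
        ((ContinuousMultilinearMap.apply ℝ (fun _ : Fin 0 => ℝ) E 0).continuous.tendsto _).comp
          (hlim 0 x)
    refine hKc.mem_of_tendsto hlim0 (Eventually.of_forall fun n => ?_)
    refine iteratedBoxAverage_mem hK hKc ha hf (hfK.mono_left (Icc_subset_Icc ?_ le_rfl))
    gcongr
    exact hsum.sum_le_tsum _ fun i _ => (ha i).le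
  · rw [← norm_iteratedFDeriv_eq_norm_iteratedDeriv]
    refine le_of_tendsto (hlim k x).norm ((eventually_ge_atTop k).mono fun n hn => ?_)
    rw [norm_iteratedFDeriv_eq_norm_iteratedDeriv]
    exact norm_iteratedDeriv_iteratedBoxAverage_le_prod ha hf hC hn x

/-! ### Univariate cutoffs -/

theorem abs_le_one_of_mem_Icc {x : ℝ} (hx : x ∈ Icc (0 : ℝ) 1) : |x| ≤ 1 :=
  (abs_of_nonneg hx.1).trans_le hx.2

theorem hasCompactSupport_deriv {E : Type*} [NormedAddCommGroup E] [NormedSpace ℝ E] {f : ℝ → E}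
    {a b : ℝ} {c c' : E} (hc : ∀ x ≤ a, f x = c) (hc' : ∀ x, b ≤ x → f x = c') :
    HasCompactSupport (deriv f) := by
  refine HasCompactSupport.intro (isCompact_Icc (a := a) (b := b)) fun x hx => ?_
  rcases not_and_or.1 hx with h | h
  · have : f =ᶠ[𝓝 x] fun _ => c := by
      filter_upwards [Iio_mem_nhds (not_le.1 h)] with y hy using hc y (le_of_lt hy)
    rw [this.deriv_eq, deriv_const]
  · have : f =ᶠ[𝓝 x] fun _ => c' := by
      filter_upwards [Ioi_mem_nhds (not_le.1 h)] with y hy using hc' y (le_of_lt hy)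
    rw [this.deriv_eq, deriv_const]

theorem exists_norm_iteratedDeriv_succ_le {E : Type*} [NormedAddCommGroup E] [NormedSpace ℝ E]
    {f : ℝ → E} (hf : ContDiff ℝ ∞ f) (hsupp : HasCompactSupport (deriv f)) (k : ℕ) :
    ∃ C, ∀ x, ‖iteratedDeriv (k + 1) f x‖ ≤ C := by
  have hcont : Continuous (iteratedFDeriv ℝ k (deriv f)) :=
    (contDiff_infty_iff_deriv.1 hf).2.continuous_iteratedFDeriv (mod_cast le_top)
  simpa only [iteratedDeriv_succ', norm_iteratedFDeriv_eq_norm_iteratedDeriv] using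
    hcont.bounded_above_of_compact_support (hsupp.iteratedFDeriv k)

/-- A smooth transition from the value `1` on `(-∞, 1]` to the value `0` on `[2, ∞)`: a univariate
cutoff function, extended to the left of `[0, ∞)` by the constant `1`. -/
structure IsCutoff (g : ℝ → ℝ) : Prop where
  contDiff : ContDiff ℝ ∞ g
  mem_Icc : ∀ x, g x ∈ Icc (0 : ℝ) 1
  eq_one : ∀ x ≤ 1, g x = 1
  eq_zero : ∀ x, 2 ≤ x → g x = 0

theorem exists_isCutoff_abs_iteratedDeriv_le_prod {a : ℕ → ℝ} (ha : ∀ n, 0 < a n)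
    (hsum : Summable a) (htsum : ∑' n, a n ≤ 1 / 2) :
    ∃ g, IsCutoff g ∧ ∀ k x, |iteratedDeriv k g x| ≤ ∏ i ∈ Finset.range k, (2 / a i) := by
  let f : ℝ → ℝ := fun x => Real.smoothTransition (3 - 2 * x)
  have hf : ContDiff ℝ ∞ f := Real.smoothTransition.contDiff.comp (by fun_prop)
  have hf01 (x : ℝ) : f x ∈ Icc (0 : ℝ) 1 :=
    ⟨Real.smoothTransition.nonneg _, Real.smoothTransition.le_one _⟩
  have hf1 (x : ℝ) (hx : x ≤ 1) : f x = 1 := Real.smoothTransition.one_of_one_le (by linarith)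
  have hf0 (x : ℝ) (hx : 3 / 2 ≤ x) : f x = 0 :=
    Real.smoothTransition.zero_of_nonpos (by linarith)
  obtain ⟨g, hg, hgK, hbound⟩ := exists_contDiff_norm_iteratedDeriv_le_prod ha hsum hf
    (exists_norm_iteratedDeriv_succ_le hf (hasCompactSupport_deriv hf1 hf0)) (C := 1)
    fun x => abs_le_one_of_mem_Icc (hf01 x)
  refine ⟨g, ⟨hg, fun x => ?_, fun x hx => ?_, fun x hx => ?_⟩, fun k x => ?_⟩
  · exact hgK _ (convex_Icc 0 1) isClosed_Icc x fun y _ => hf01 y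
  · exact hgK {1} (convex_singleton 1) isClosed_singleton x fun y hy => hf1 y (hy.2.trans hx)
  · exact hgK {0} (convex_singleton 0) isClosed_singleton x
      fun y hy => hf0 y (by linarith [hy.1])
  · simpa using hbound k x

/-! ### Geometric bounds on derivatives -/

theorem norm_iteratedDeriv_mul_le {𝔸 : Type*} [NormedRing 𝔸] [NormedAlgebra ℝ 𝔸] {f h : ℝ → 𝔸}
    {k : ℕ} (hf : ContDiff ℝ k f) (hh : ContDiff ℝ k h) (x : ℝ) :
    ‖iteratedDeriv k (fun y => f y * h y) x‖ ≤ ∑ i ∈ Finset.range (k + 1),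
      (k.choose i : ℝ) * ‖iteratedDeriv i f x‖ * ‖iteratedDeriv (k - i) h x‖ := by
  simpa only [norm_iteratedFDeriv_eq_norm_iteratedDeriv] using
    norm_iteratedFDeriv_mul_le hf hh x le_rfl

/-- By Leibniz' rule and Bernoulli's inequality `(i + 1) |c| ≤ (1 + |c|) ^ (i + 1)`, the derivative
is a sum of `k + 1` terms, each at most `k! ((1 + |c|) R) ^ (k + 1)`. -/
theorem norm_iteratedDeriv_smul_deriv_mul_le {𝔸 : Type*} [NormedRing 𝔸] [NormedAlgebra ℝ 𝔸]
    {f h : ℝ → 𝔸} {k : ℕ} {c R x : ℝ} (hf : ContDiff ℝ (k + 1) f) (hh : ContDiff ℝ k h)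
    (hR : 0 ≤ R) (hfR : ∀ i ≤ k + 1, ‖iteratedDeriv i f x‖ ≤ i ! * R ^ i)
    (hhR : ∀ i ≤ k, ‖iteratedDeriv i h x‖ ≤ i ! * ((1 + |c|) * R) ^ i) :
    ‖iteratedDeriv k (fun y => c • (deriv f y * h y)) x‖ ≤
      (k + 1)! * ((1 + |c|) * R) ^ (k + 1) := by
  have hterm : ∀ i ∈ Finset.range (k + 1), |c| * (k.choose i * ‖iteratedDeriv i (deriv f) x‖ *
      ‖iteratedDeriv (k - i) h x‖) ≤ k ! * ((1 + |c|) * R) ^ (k + 1) := by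
    intro i hi
    have hik : i ≤ k := Finset.mem_range_succ_iff.1 hi
    have hbern : |c| * (i + 1) ≤ (1 + |c|) ^ (i + 1) := by
      have := one_add_mul_le_pow (show (-2 : ℝ) ≤ |c| by linarith [abs_nonneg c]) (i + 1)
      push_cast at this
      linarith
    have hfac : (k.choose i : ℝ) * i ! * (k - i)! = k ! :=
      mod_cast Nat.choose_mul_factorial_mul_factorial hik
    calc |c| * (k.choose i * ‖iteratedDeriv i (deriv f) x‖ * ‖iteratedDeriv (k - i) h x‖)
        ≤ |c| * (k.choose i * ((i + 1)! * R ^ (i + 1)) *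
            ((k - i)! * ((1 + |c|) * R) ^ (k - i))) := by
          rw [← iteratedDeriv_succ']
          gcongr
          · exact hfR (i + 1) (by lia)
          · exact hhR (k - i) (Nat.sub_le k i)
      _ = k ! * (|c| * (i + 1) * R ^ (i + 1) * ((1 + |c|) * R) ^ (k - i)) := by
          rw [← hfac, Nat.factorial_succ]
          push_cast
          ring
      _ ≤ k ! * ((1 + |c|) ^ (i + 1) * R ^ (i + 1) * ((1 + |c|) * R) ^ (k - i)) := by gcongr
      _ = k ! * ((1 + |c|) * R) ^ (k + 1) := by
          rw [← mul_pow, ← pow_add, show i + 1 + (k - i) = k + 1 by lia]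
  rw [iteratedDeriv_fun_const_smul_field, norm_smul, Real.norm_eq_abs]
  calc |c| * ‖iteratedDeriv k (fun y => deriv f y * h y) x‖
      ≤ |c| * ∑ i ∈ Finset.range (k + 1),
          (k.choose i : ℝ) * ‖iteratedDeriv i (deriv f) x‖ * ‖iteratedDeriv (k - i) h x‖ := by
        gcongr
        exact norm_iteratedDeriv_mul_le hf.deriv' hh x
    _ ≤ ∑ _ ∈ Finset.range (k + 1), k ! * ((1 + |c|) * R) ^ (k + 1) := by
        rw [Finset.mul_sum]
        exact Finset.sum_le_sum hterm
    _ = (k + 1)! * ((1 + |c|) * R) ^ (k + 1) := by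
        rw [Finset.sum_const, Finset.card_range, nsmul_eq_mul, Nat.factorial_succ]
        push_cast
        ring

/-- The function `f` is of class `C^N` and its derivatives up to order `N` are at most those of
`x ↦ 1 / (1 - R * x)` at `0`, that is, `‖f⁽ᵏ⁾‖ ≤ k! Rᵏ` for `k ≤ N`. -/
structure HasGeometricDerivs {E : Type*} [NormedAddCommGroup E] [NormedSpace ℝ E]
    (N : ℕ) (R : ℝ) (f : ℝ → E) : Prop where
  contDiff : ContDiff ℝ N f
  nonneg : 0 ≤ R
  norm_iteratedDeriv_le : ∀ k ≤ N, ∀ x, ‖iteratedDeriv k f x‖ ≤ k ! * R ^ k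

namespace HasGeometricDerivs

variable {E F : Type*} [NormedAddCommGroup E] [NormedSpace ℝ E] [NormedAddCommGroup F]
  [NormedSpace ℝ F] {N : ℕ} {R S : ℝ}

theorem mono {f : ℝ → E} (hf : HasGeometricDerivs N R f) (hRS : R ≤ S) :
    HasGeometricDerivs N S f where
  contDiff := hf.contDiff
  nonneg := hf.nonneg.trans hRS
  norm_iteratedDeriv_le k hk x := by
    have := hf.nonneg
    exact (hf.norm_iteratedDeriv_le k hk x).trans (by gcongr)

theorem clm_comp {f : ℝ → E} (hf : HasGeometricDerivs N R f) (T : E →L[ℝ] F) (hT : ‖T‖ ≤ 1) :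
    HasGeometricDerivs N R (T ∘ f) where
  contDiff := T.contDiff.comp hf.contDiff
  nonneg := hf.nonneg
  norm_iteratedDeriv_le k hk x := by
    have hTk := T.norm_iteratedFDeriv_comp_left (hf.contDiff.contDiffAt (x := x))
      (Nat.cast_le.2 hk)
    rw [norm_iteratedFDeriv_eq_norm_iteratedDeriv, norm_iteratedFDeriv_eq_norm_iteratedDeriv]
      at hTk
    exact hTk.trans <| (mul_le_of_le_one_left (norm_nonneg _) hT).trans
      (hf.norm_iteratedDeriv_le k hk x)

theorem comp_const_mul {f : ℝ → E} (hf : HasGeometricDerivs N R f) (c : ℝ) :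
    HasGeometricDerivs N (|c| * R) fun x => f (c * x) where
  contDiff := hf.contDiff.comp (by fun_prop)
  nonneg := mul_nonneg (abs_nonneg c) hf.nonneg
  norm_iteratedDeriv_le k hk x := by
    rw [iteratedDeriv_comp_const_smul (hf.contDiff.of_le (Nat.cast_le.2 hk)), norm_smul, norm_pow,
      Real.norm_eq_abs]
    calc |c| ^ k * ‖iteratedDeriv k f (c * x)‖ ≤ |c| ^ k * (k ! * R ^ k) := by
          gcongr; exact hf.norm_iteratedDeriv_le k hk _
      _ = k ! * (|c| * R) ^ k := by rw [mul_pow]; ring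

variable {𝔸 : Type*} [NormedRing 𝔸] [NormedAlgebra ℝ 𝔸]

theorem mul {f h : ℝ → 𝔸} (hf : HasGeometricDerivs N R f) (hh : HasGeometricDerivs N S h) :
    HasGeometricDerivs N (R + S) fun x => f x * h x where
  contDiff := hf.contDiff.mul hh.contDiff
  nonneg := add_nonneg hf.nonneg hh.nonneg
  norm_iteratedDeriv_le k hk x := by
    have hR := hf.nonneg
    have hS := hh.nonneg
    have hkN : (k : ℕ∞ω) ≤ N := Nat.cast_le.2 hk
    calc ‖iteratedDeriv k (fun y => f y * h y) x‖
        ≤ ∑ i ∈ Finset.range (k + 1),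
            (k.choose i : ℝ) * ‖iteratedDeriv i f x‖ * ‖iteratedDeriv (k - i) h x‖ :=
          norm_iteratedDeriv_mul_le (hf.contDiff.of_le hkN) (hh.contDiff.of_le hkN) x
      _ ≤ ∑ i ∈ Finset.range (k + 1), k ! * (R ^ i * S ^ (k - i) * k.choose i) := by
          refine Finset.sum_le_sum fun i hi => ?_
          have hik : i ≤ k := Finset.mem_range_succ_iff.1 hi
          have hfac : ((i ! * (k - i)! : ℕ) : ℝ) ≤ k ! := Nat.cast_le.2 <|
            Nat.le_of_dvd k.factorial_pos (Nat.factorial_mul_factorial_dvd_factorial hik)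
          calc (k.choose i : ℝ) * ‖iteratedDeriv i f x‖ * ‖iteratedDeriv (k - i) h x‖
              ≤ k.choose i * (i ! * R ^ i) * ((k - i)! * S ^ (k - i)) := by
                gcongr
                · exact hf.norm_iteratedDeriv_le i (hik.trans hk) x
                · exact hh.norm_iteratedDeriv_le (k - i) ((Nat.sub_le k i).trans hk) x
            _ = (i ! * (k - i)! : ℕ) * (R ^ i * S ^ (k - i) * k.choose i) := by push_cast; ring
            _ ≤ k ! * (R ^ i * S ^ (k - i) * k.choose i) := by gcongr
      _ = k ! * (R + S) ^ k := by rw [add_pow, Finset.mul_sum]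

theorem of_norm_iteratedDeriv_le_prod {f : ℝ → E} {b : ℕ → ℝ} {n : ℕ}
    (hf : ContDiff ℝ (n + 1 : ℕ) f) (hb0 : 0 ≤ b 0) (hb : Monotone b)
    (hfb : ∀ k x, ‖iteratedDeriv k f x‖ ≤ ∏ i ∈ Finset.range k, ((i + 1) * b i)) :
    HasGeometricDerivs (n + 1) (b n) f where
  contDiff := hf
  nonneg := hb0.trans (hb n.zero_le)
  norm_iteratedDeriv_le k hk x := by
    calc ‖iteratedDeriv k f x‖ ≤ ∏ i ∈ Finset.range k, ((i + 1) * b i) := hfb k x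
      _ ≤ ∏ i ∈ Finset.range k, ((i + 1) * b n) := by
          refine Finset.prod_le_prod (fun i _ => ?_) fun i hi => ?_
          · exact mul_nonneg (by positivity) (hb0.trans (hb i.zero_le))
          · have hin : i ≤ n := Nat.lt_succ_iff.1 ((Finset.mem_range.1 hi).trans_le hk)
            gcongr
            exact hb hin
      _ = k ! * b n ^ k := by
          rw [Finset.prod_mul_distrib, Finset.prod_const, Finset.card_range,
            ← Finset.prod_range_add_one_eq_factorial]
          push_cast
          rfl

theorem of_deriv_eq {f h : ℝ → 𝔸} {c : ℝ} (hf : HasGeometricDerivs N R f) (hh : ContDiff ℝ N h)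
    (hh1 : ∀ x, ‖h x‖ ≤ 1) (hderiv : deriv h = fun x => c • (deriv f x * h x)) :
    HasGeometricDerivs N ((1 + |c|) * R) h where
  contDiff := hh
  nonneg := mul_nonneg (by positivity) hf.nonneg
  norm_iteratedDeriv_le k hk x := by
    induction k using Nat.strong_induction_on with
    | _ k ih =>
    rcases k with _ | k
    · simpa using hh1 x
    · rw [iteratedDeriv_succ', hderiv]
      exact norm_iteratedDeriv_smul_deriv_mul_le (hf.contDiff.of_le (mod_cast hk))
        (hh.of_le (mod_cast (Nat.le_succ k).trans hk)) hf.nonneg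
        (fun i hi => hf.norm_iteratedDeriv_le i (hi.trans hk) x)
        fun i hi => ih i (Nat.lt_succ_of_le hi) (by lia)

theorem cexp_mul_I {f : ℝ → ℝ} (hf : HasGeometricDerivs N R f) (c : ℝ) :
    HasGeometricDerivs N ((1 + |c|) * R) fun x => Complex.exp ((c * f x : ℝ) * Complex.I) := by
  let T : ℝ →L[ℝ] ℂ := ContinuousLinearMap.toSpanSingleton ℝ Complex.I
  have hTf := hf.clm_comp T (by simp [T])
  have hcont : ContDiff ℝ N fun x => Complex.exp ((c * f x : ℝ) * Complex.I) :=
    ((Complex.ofRealCLM.contDiff.comp (contDiff_const.mul hf.contDiff)).mul contDiff_const).cexp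
  have hnorm (x : ℝ) : ‖Complex.exp ((c * f x : ℝ) * Complex.I)‖ ≤ 1 :=
    (Complex.norm_exp_ofReal_mul_I _).le
  rcases N with _ | N
  · exact ⟨hcont, mul_nonneg (by positivity) hf.nonneg, by simpa using hnorm⟩
  refine hTf.of_deriv_eq hcont hnorm (funext fun x => ?_)
  have hfx : HasDerivAt f (deriv f x) x :=
    (hf.contDiff.differentiable (by simp) x).hasDerivAt
  rw [(T.hasFDerivAt.comp_hasDerivAt x hfx).deriv,
    (((hfx.const_mul c).ofReal_comp.mul_const Complex.I).cexp).deriv]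
  simp only [T, Complex.ofReal_mul, ContinuousLinearMap.toSpanSingleton_apply, Complex.real_smul]
  ring

theorem sin_const_mul {f : ℝ → ℝ} (hf : HasGeometricDerivs N R f) (c : ℝ) :
    HasGeometricDerivs N ((1 + |c|) * R) fun x => Real.sin (c * f x) := by
  simpa only [Function.comp_def, Complex.imCLM_apply, Complex.exp_ofReal_mul_I_im] using
    (hf.cexp_mul_I c).clm_comp Complex.imCLM Complex.imCLM_norm.le

theorem cos_const_mul {f : ℝ → ℝ} (hf : HasGeometricDerivs N R f) (c : ℝ) :
    HasGeometricDerivs N ((1 + |c|) * R) fun x => Real.cos (c * f x) := by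
  simpa only [Function.comp_def, Complex.reCLM_apply, Complex.exp_ofReal_mul_I_re] using
    (hf.cexp_mul_I c).clm_comp Complex.reCLM Complex.reCLM_norm.le

theorem const_mul {f : ℝ → ℝ} (hf : HasGeometricDerivs N R f) {c : ℝ} (hc : |c| ≤ 1) :
    HasGeometricDerivs N R fun x => c * f x :=
  hf.clm_comp (c • ContinuousLinearMap.id ℝ ℝ) (by simpa [norm_smul] using hc)

end HasGeometricDerivs

/-! ### The univariate cutoff of a growth function -/

namespace IsGrowthFunction

variable {L : ℝ → ℝ}

theorem antitoneOn_one_div_mul (hL : IsGrowthFunction L) :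
    AntitoneOn (fun t : ℝ => 1 / ((t + 1) * L t)) (Ici 0) := by
  intro s hs t ht hst
  have hLs := hL.one_le s hs
  have hs0 : 0 ≤ s := hs
  have ht0 : 0 ≤ t := ht
  have hLst := hL.monotoneOn hs ht hst
  exact one_div_le_one_div_of_le (by positivity) (by gcongr)

theorem one_div_mul_pos (hL : IsGrowthFunction L) {t : ℝ} (ht : 0 ≤ t) :
    0 < 1 / ((t + 1) * L t) := by
  have := hL.one_le t ht
  positivity

theorem summable_one_div_mul (hL : IsGrowthFunction L) :
    Summable fun n : ℕ => 1 / ((n + 1 : ℝ) * L n) :=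
  hL.antitoneOn_one_div_mul.summable_of_integrableOn_Ioi_zero hL.integrableOn
    fun _ ht => (hL.one_div_mul_pos (le_of_lt ht)).le

theorem tsum_one_div_mul_le_growthConst (hL : IsGrowthFunction L) :
    ∑' n : ℕ, 1 / ((n + 1 : ℝ) * L n) ≤ growthConst L := by
  have := hL.antitoneOn_one_div_mul.tsum_le_integral hL.integrableOn
    fun _ ht => (hL.one_div_mul_pos (le_of_lt ht)).le
  simpa [growthConst, hL.map_zero] using this

theorem one_le_growthConst (hL : IsGrowthFunction L) : 1 ≤ growthConst L :=
  le_add_of_nonneg_right <| setIntegral_nonneg measurableSet_Ioi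
    fun _ ht => (hL.one_div_mul_pos (le_of_lt ht)).le

theorem exists_isCutoff (hL : IsGrowthFunction L) :
    ∃ g, IsCutoff g ∧ ∀ n : ℕ, HasGeometricDerivs (n + 1) (4 * growthConst L * L n) g := by
  have hM := hL.one_le_growthConst
  have hLpos (n : ℕ) : 0 < L n := one_pos.trans_le (hL.one_le n n.cast_nonneg)
  have hLmono : Monotone fun n : ℕ => L n := fun m n hmn =>
    hL.monotoneOn (mem_Ici.2 m.cast_nonneg) (mem_Ici.2 n.cast_nonneg) (Nat.cast_le.2 hmn)
  let a : ℕ → ℝ := fun n => 1 / ((n + 1) * L n) * (1 / (2 * growthConst L))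
  have ha (n : ℕ) : 0 < a n := mul_pos (hL.one_div_mul_pos n.cast_nonneg) (by positivity)
  have htsum : ∑' n, a n ≤ 1 / 2 := by
    rw [tsum_mul_right]
    calc (∑' n : ℕ, 1 / ((n + 1 : ℝ) * L n)) * (1 / (2 * growthConst L))
        ≤ growthConst L * (1 / (2 * growthConst L)) := by
          gcongr; exact hL.tsum_one_div_mul_le_growthConst
      _ = 1 / 2 := by field_simp
  obtain ⟨g, hg, hbound⟩ :=
    exists_isCutoff_abs_iteratedDeriv_le_prod ha (hL.summable_one_div_mul.mul_right _) htsum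
  refine ⟨g, hg, fun n => .of_norm_iteratedDeriv_le_prod (hg.contDiff.of_le (mod_cast le_top))
    (mul_pos (by positivity) (hLpos 0)).le (hLmono.const_mul (by positivity))
    fun k x => (hbound k x).trans_eq ?_⟩
  refine Finset.prod_congr rfl fun i _ => ?_
  have := (hLpos i).ne'
  simp only [a]
  field_simp
  ring

end IsGrowthFunction

/-! ### Tensor products of cutoffs -/

/-- The tensor product `t ↦ ∏ i, g (t i)` of copies of a univariate function `g`. -/
noncomputable def tensorCutoff {ι : Type*} [Fintype ι] (g : ℝ → ℝ) (t : ι → ℝ) : ℝ :=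
  ∏ i, g (t i)

section TensorCutoff

variable {ι : Type*} [Fintype ι] {g : ℝ → ℝ} {t : ι → ℝ}

theorem contDiff_tensorCutoff {n : ℕ∞ω} (hg : ContDiff ℝ n g) :
    ContDiff ℝ n (tensorCutoff (ι := ι) g) :=
  contDiff_prod fun i _ => hg.comp (contDiff_apply ℝ ℝ i)

theorem tensorCutoff_mem_Icc (hg : ∀ x, g x ∈ Icc (0 : ℝ) 1) (t : ι → ℝ) :
    tensorCutoff g t ∈ Icc (0 : ℝ) 1 :=
  ⟨Finset.prod_nonneg fun i _ => (hg (t i)).1,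
    Finset.prod_le_one (fun i _ => (hg (t i)).1) fun i _ => (hg (t i)).2⟩

theorem tensorCutoff_update [DecidableEq ι] (g : ℝ → ℝ) (t : ι → ℝ) (j : ι) (s : ℝ) :
    tensorCutoff g (Function.update t j s) = (∏ i ∈ Finset.univ.erase j, g (t i)) * g s := by
  rw [tensorCutoff, ← Finset.prod_erase_mul _ _ (Finset.mem_univ j), Function.update_self]
  congr 1
  exact Finset.prod_congr rfl fun i hi => by rw [Function.update_of_ne (Finset.ne_of_mem_erase hi)]

theorem HasGeometricDerivs.tensorCutoff_update [DecidableEq ι] {N : ℕ} {R : ℝ}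
    (hgR : HasGeometricDerivs N R g) (hg : ∀ x, |g x| ≤ 1) (t : ι → ℝ) (j : ι) :
    HasGeometricDerivs N R fun s => tensorCutoff g (Function.update t j s) := by
  simp only [_root_.tensorCutoff_update]
  refine hgR.const_mul ?_
  rw [Finset.abs_prod]
  exact Finset.prod_le_one (fun i _ => abs_nonneg _) fun i _ => hg _

namespace IsCutoff

theorem tensorCutoff_eq_one (hg : IsCutoff g) (ht : ∀ i, t i ≤ 1) : tensorCutoff g t = 1 :=
  Finset.prod_eq_one fun i _ => hg.eq_one _ (ht i)

theorem tensorCutoff_eq_zero (hg : IsCutoff g) {i : ι} (hi : 2 ≤ t i) : tensorCutoff g t = 0 :=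
  Finset.prod_eq_zero (Finset.mem_univ i) (hg.eq_zero _ hi)

theorem tensorCutoff_two_smul_eq_zero (hg : IsCutoff g) {i : ι} (hi : 1 ≤ t i) :
    tensorCutoff g ((2 : ℝ) • t) = 0 :=
  hg.tensorCutoff_eq_zero (i := i) (by rw [Pi.smul_apply, smul_eq_mul]; linarith)

theorem tensorCutoff_eq_one_or (hg : IsCutoff g) (t : ι → ℝ) :
    tensorCutoff g t = 1 ∨ tensorCutoff g ((2 : ℝ) • t) = 0 := by
  by_cases h : ∀ i, t i ≤ 1
  · exact .inl (hg.tensorCutoff_eq_one h)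
  · push Not at h
    obtain ⟨i, hi⟩ := h
    exact .inr (hg.tensorCutoff_two_smul_eq_zero hi.le)

theorem tendsto_tensorCutoff_zero (hg : IsCutoff g) :
    Tendsto (tensorCutoff (ι := ι) g) (𝓝 0) (𝓝 1) := by
  rw [← hg.tensorCutoff_eq_one (t := (0 : ι → ℝ)) fun _ => zero_le_one]
  exact (contDiff_tensorCutoff hg.contDiff).continuous.tendsto 0

end IsCutoff

theorem exists_apply_eq_norm [Nonempty ι] (ht : ∀ i, 0 ≤ t i) : ∃ i, t i = ‖t‖ := by
  obtain ⟨i, hi⟩ := Finite.exists_max t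
  refine ⟨i, le_antisymm ((le_abs_self _).trans (norm_le_pi_norm t i)) ?_⟩
  refine (pi_norm_le_iff_of_nonneg (ht i)).2 fun l => ?_
  rw [Real.norm_of_nonneg (ht l)]
  exact hi l

end TensorCutoff

/-! ### Dyadic partitions of unity -/

/-- The factor `sin (π / 2 * G x) * cos (π / 2 * G (2 x))` of a quadratic dyadic partition of
unity; its square is a difference of consecutive dyadic dilates of `sin (π / 2 * G) ^ 2`, at least
when at each `x` either `G x = 1` or `G (2 x) = 0`. -/
noncomputable def dyadicPiece {E : Type*} [SMul ℝ E] (G : E → ℝ) (x : E) : ℝ :=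
  Real.sin (Real.pi / 2 * G x) * Real.cos (Real.pi / 2 * G ((2 : ℝ) • x))

section DyadicPiece

theorem dyadicPiece_mem_Icc {E : Type*} [SMul ℝ E] {G : E → ℝ} (hG : ∀ x, G x ∈ Icc (0 : ℝ) 1)
    (x : E) : dyadicPiece G x ∈ Icc (0 : ℝ) 1 := by
  have hangle (y : E) : 0 ≤ Real.pi / 2 * G y ∧ Real.pi / 2 * G y ≤ Real.pi / 2 :=
    ⟨mul_nonneg (by positivity) (hG y).1, mul_le_of_le_one_right (by positivity) (hG y).2⟩
  have hsin : 0 ≤ Real.sin (Real.pi / 2 * G x) :=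
    Real.sin_nonneg_of_nonneg_of_le_pi (hangle x).1 (by linarith [(hangle x).2, Real.pi_pos])
  have hcos : 0 ≤ Real.cos (Real.pi / 2 * G ((2 : ℝ) • x)) :=
    Real.cos_nonneg_of_neg_pi_div_two_le_of_le (by linarith [(hangle ((2 : ℝ) • x)).1, Real.pi_pos])
      (hangle _).2
  exact ⟨mul_nonneg hsin hcos, mul_le_one₀ (Real.sin_le_one _) hcos (Real.cos_le_one _)⟩

theorem dyadicPiece_eq_zero_of_eq_zero {E : Type*} [SMul ℝ E] {G : E → ℝ} {x : E}
    (hx : G x = 0) : dyadicPiece G x = 0 := by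
  simp [dyadicPiece, hx]

theorem dyadicPiece_eq_zero_of_two_smul_eq_one {E : Type*} [SMul ℝ E] {G : E → ℝ} {x : E}
    (hx : G ((2 : ℝ) • x) = 1) : dyadicPiece G x = 0 := by
  simp [dyadicPiece, hx]

theorem sq_dyadicPiece {E : Type*} [SMul ℝ E] {G : E → ℝ} {x : E}
    (hx : G x = 1 ∨ G ((2 : ℝ) • x) = 0) :
    dyadicPiece G x ^ 2 =
      Real.sin (Real.pi / 2 * G x) ^ 2 - Real.sin (Real.pi / 2 * G ((2 : ℝ) • x)) ^ 2 := by
  rcases hx with hx | hx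
  · simp [dyadicPiece, hx, Real.cos_sq']
  · simp [dyadicPiece, hx]

theorem contDiff_dyadicPiece {E : Type*} [NormedAddCommGroup E] [NormedSpace ℝ E] {G : E → ℝ}
    {n : ℕ∞ω} (hG : ContDiff ℝ n G) : ContDiff ℝ n (dyadicPiece G) :=
  (contDiff_const.mul hG).sin.mul (contDiff_const.mul (hG.comp (contDiff_const_smul (2 : ℝ)))).cos

theorem hasSum_sq_dyadicPiece {E : Type*} [AddCommGroup E] [Module ℝ E] [TopologicalSpace E]
    [ContinuousSMul ℝ E] {G : E → ℝ} (hG : ∀ x, G x = 1 ∨ G ((2 : ℝ) • x) = 0)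
    (hG0 : Tendsto G (𝓝 0) (𝓝 1)) {x : E} (hx : G ((2 : ℝ) • x) = 0) :
    HasSum (fun j : ℕ => dyadicPiece G (((2 : ℝ) ^ j)⁻¹ • x) ^ 2) 1 := by
  let p : ℕ → ℝ := fun j => Real.sin (Real.pi / 2 * G ((2 : ℝ) • ((2 : ℝ) ^ j)⁻¹ • x)) ^ 2
  have hterm (j : ℕ) : dyadicPiece G (((2 : ℝ) ^ j)⁻¹ • x) ^ 2 = p (j + 1) - p j := by
    have hscale : (2 : ℝ) • ((2 : ℝ) ^ (j + 1))⁻¹ • x = ((2 : ℝ) ^ j)⁻¹ • x := by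
      rw [smul_smul, pow_succ, mul_inv_rev, mul_inv_cancel_left₀ two_ne_zero]
    simp only [p, hscale, sq_dyadicPiece (hG _)]
  have hp0 : p 0 = 0 := by simp [p, hx]
  have hscale0 : Tendsto (fun j : ℕ => (2 : ℝ) • ((2 : ℝ) ^ j)⁻¹ • x) atTop (𝓝 0) := by
    have hpow : Tendsto (fun j : ℕ => ((2 : ℝ) ^ j)⁻¹) atTop (𝓝 0) :=
      tendsto_inv_atTop_zero.comp (tendsto_pow_atTop_atTop_of_one_lt one_lt_two)
    simpa using (hpow.smul_const x).const_smul (2 : ℝ)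
  have hp : Tendsto p atTop (𝓝 1) := by
    simpa using ((Real.continuous_sin.tendsto _).comp
      ((hG0.comp hscale0).const_mul (Real.pi / 2))).pow 2
  rw [hasSum_iff_tendsto_nat_of_nonneg fun j => sq_nonneg _]
  simpa only [hterm, Finset.sum_range_sub, hp0, sub_zero] using hp

theorem HasGeometricDerivs.dyadicPiece_update {ι : Type*} [DecidableEq ι] {N : ℕ} {R : ℝ}
    {G : (ι → ℝ) → ℝ} {j : ι}
    (hG : ∀ t, HasGeometricDerivs N R fun s => G (Function.update t j s)) (t : ι → ℝ) :
    HasGeometricDerivs N (8 * R) fun s => dyadicPiece G (Function.update t j s) := by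
  have hR := (hG t).nonneg
  have hsin := (hG t).sin_const_mul (Real.pi / 2)
  have hcos := ((hG ((2 : ℝ) • t)).comp_const_mul 2).cos_const_mul (Real.pi / 2)
  have hradius : (1 + |Real.pi / 2|) * R + (1 + |Real.pi / 2|) * (|2| * R) ≤ 8 * R := by
    rw [abs_of_pos Real.pi_div_two_pos, abs_two]
    nlinarith [Real.pi_lt_d2]
  refine HasGeometricDerivs.mono ?_ hradius
  simpa only [dyadicPiece, ← Function.update_smul, smul_eq_mul] using hsin.mul hcos

end DyadicPiece

/-! ### Admissible functions with small derivatives -/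

section Admissible

variable {d : ℕ} {g : ℝ → ℝ} {A : (Fin d → ℝ) → ℝ}

theorem apply_le_one_of_mem_ballOne {t : Fin d → ℝ} (ht : t ∈ ballOne d) (i : Fin d) :
    t i ≤ 1 :=
  calc t i ≤ |t i| := le_abs_self _
    _ ≤ ∑ i, |t i| := 
        Finset.single_le_sum (fun i _ => abs_nonneg (t i)) (Finset.mem_univ i)
    _ ≤ 1 := ht.2

theorem closure_support_subset (hA : ∀ t i, 2 ≤ t i → A t = 0) :
    closure {t | t ∈ orthant d ∧ A t ≠ 0} ⊆ {t | ∀ i, t i ∈ Icc (0 : ℝ) 2} := by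
  refine closure_minimal (fun t ht i => ⟨ht.1 i, ?_⟩) ?_
  · exact le_of_not_ge fun h => ht.2 (hA t i h)
  · simp only [ofPred_forall]
    exact isClosed_iInter fun i => isClosed_Icc.preimage (continuous_apply i)

theorem IsCutoff.tensorCutoff_coordProj (hg : IsCutoff g) {t : Fin d → ℝ} (ht : t ∈ orthant d)
    {k : Fin d} (hk : t k ≤ 1 / 2 * ‖t‖) : tensorCutoff g (coordProj k t) = tensorCutoff g t := by
  rcases lt_or_ge ‖t‖ 2 with hnorm | hnorm
  · conv_rhs => rw [← Function.update_eq_self k t]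
    rw [coordProj, tensorCutoff_update, tensorCutoff_update, hg.eq_one (t k) (by linarith),
      hg.eq_one 0 zero_le_one]
  · have : Nonempty (Fin d) := ⟨k⟩
    obtain ⟨i, hi⟩ := exists_apply_eq_norm ht
    have hik : i ≠ k := by
      rintro rfl
      linarith
    have hproj : coordProj k t i = t i := Function.update_of_ne hik _ _
    rw [hg.tensorCutoff_eq_zero (i := i) (by linarith),
      hg.tensorCutoff_eq_zero (i := i) (by linarith)]

theorem IsCutoff.isAdmissibleSecondKind_tensorCutoff (hg : IsCutoff g) :
    IsAdmissibleSecondKind .a (tensorCutoff (ι := Fin d) g) where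
  contDiffOn := (contDiff_tensorCutoff hg.contDiff).contDiffOn
  support_subset := closure_support_subset fun _ _ h => hg.tensorCutoff_eq_zero h
  eq_proj _ ht _ hk := (hg.tensorCutoff_coordProj ht hk).symm
  hasType _ ht := hg.tensorCutoff_eq_one (apply_le_one_of_mem_ballOne ht)

theorem IsCutoff.dyadicPiece_tensorCutoff_coordProj (hg : IsCutoff g) {t : Fin d → ℝ}
    (ht : t ∈ orthant d) {k : Fin d} (hk : t k ≤ 1 / 2 * ‖t‖) :
    dyadicPiece (tensorCutoff g) (coordProj k t) = dyadicPiece (tensorCutoff g) t := by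
  have h2t : (2 : ℝ) • t ∈ orthant d := fun i => mul_nonneg zero_le_two (ht i)
  have h2k : ((2 : ℝ) • t) k ≤ 1 / 2 * ‖(2 : ℝ) • t‖ := by
    rw [norm_smul, Pi.smul_apply, smul_eq_mul, Real.norm_ofNat]
    linarith
  have hsmul : (2 : ℝ) • coordProj k t = coordProj k ((2 : ℝ) • t) := by
    rw [coordProj, coordProj, ← Function.update_smul, smul_zero]
  rw [dyadicPiece, dyadicPiece, hsmul, hg.tensorCutoff_coordProj ht hk,
    hg.tensorCutoff_coordProj h2t h2k]

theorem IsCutoff.isAdmissibleSecondKind_dyadicPiece (hg : IsCutoff g) :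
    IsAdmissibleSecondKind .c (dyadicPiece (tensorCutoff (ι := Fin d) g)) where
  contDiffOn := (contDiff_dyadicPiece (contDiff_tensorCutoff hg.contDiff)).contDiffOn
  support_subset := closure_support_subset fun _ _ h =>
    dyadicPiece_eq_zero_of_eq_zero (hg.tensorCutoff_eq_zero h)
  eq_proj _ ht _ hk := (hg.dyadicPiece_tensorCutoff_coordProj ht hk).symm
  hasType := by
    refine ⟨?_, fun t ht => ?_⟩
    · rintro _ ⟨u, hu, rfl⟩
      refine dyadicPiece_eq_zero_of_two_smul_eq_one ?_
      simpa [smul_smul] using hg.tensorCutoff_eq_one (apply_le_one_of_mem_ballOne hu)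
    · obtain ⟨i, hi⟩ : ∃ i, 1 ≤ t i := by
        by_contra! h
        exact ht.2 fun i => ⟨ht.1 i, h i⟩
      simpa only [sq_abs] using hasSum_sq_dyadicPiece hg.tensorCutoff_eq_one_or
        hg.tendsto_tensorCutoff_zero (hg.tensorCutoff_two_smul_eq_zero hi)

theorem IsAdmissibleSecondKind.b_of_c (hA : IsAdmissibleSecondKind .c A) :
    IsAdmissibleSecondKind .b A :=
  { hA with hasType := hA.hasType.1 }

theorem mem_smallDerivClass_one {L : ℝ → ℝ} {c : ℝ} (hA : ContDiffOn ℝ ∞ A (orthant d))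
    (hA1 : ∀ t ∈ orthant d, |A t| ≤ 1)
    (hder : ∀ n : ℕ, ∀ j, ∀ t ∈ orthant d,
      HasGeometricDerivs (n + 1) (c * L n) fun s => A (Function.update t j s)) :
    A ∈ smallDerivClass d L 1 c := by
  refine ⟨hA, hA1, fun k hk j t ht => ?_⟩
  obtain ⟨n, rfl⟩ := Nat.exists_eq_add_of_le' hk
  have hgeom := hder n j t ht
  rw [partialDeriv, iteratedDerivWithin_eq_iteratedDeriv (uniqueDiffOn_Ici 0)
    hgeom.contDiff.contDiffAt (ht j), one_div_mul_eq_div, div_le_iff₀ (by positivity), one_mul,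
    mul_comm, Nat.cast_succ, add_sub_cancel_right]
  exact hgeom.norm_iteratedDeriv_le (n + 1) le_rfl (t j)

theorem smallDerivClass_mono {L : ℝ → ℝ} (hL : ∀ t, 0 ≤ t → 0 ≤ L t) {γ δ γ' δ' : ℝ}
    (hγδ : γ ≤ δ) (hγ' : 0 ≤ γ') (hγδ' : γ' ≤ δ') :
    smallDerivClass d L γ γ' ⊆ smallDerivClass d L δ δ' := by
  rintro A ⟨hcont, hA, hder⟩
  refine ⟨hcont, fun t ht => (hA t ht).trans hγδ, fun k hk j t ht => (hder k hk j t ht).trans ?_⟩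
  have hLk : 0 ≤ L ((k : ℝ) - 1) := hL _ (sub_nonneg.2 (Nat.one_le_cast.2 hk))
  have hγ : 0 ≤ γ := (abs_nonneg _).trans (hA t ht)
  have hδ : 0 ≤ δ := hγ.trans hγδ
  gcongr

end Admissible

theorem thirty_two_mul_le_of_one_le {d M : ℝ} (hd : 1 ≤ d) (hM : 1 ≤ M) :
    32 * M ≤ 10 * d * (2 * d - 1) * M * (8 * (d + 2) * M + 1) := by
  have hdim : 1 ≤ d * (2 * d - 1) := by nlinarith
  have hfactor : 24 ≤ 8 * (d + 2) * M := by nlinarith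
  calc 32 * M ≤ 10 * 1 * M * (24 + 1) := by linarith
    _ ≤ 10 * (d * (2 * d - 1)) * M * (8 * (d + 2) * M + 1) := by gcongr
    _ = 10 * d * (2 * d - 1) * M * (8 * (d + 2) * M + 1) := by ring

theorem mainTheorem9_general (d : ℕ) (L : ℝ → ℝ) (hL : IsGrowthFunction L) (τ : CutoffType) :
    ∃ A ∈ smallDerivClass d L 1 (32 * growthConst L),
      IsAdmissibleSecondKind τ A ∧ ∀ t ∈ orthant d, 0 ≤ A t ∧ A t ≤ 1 := by
  obtain ⟨g, hg, hgR⟩ := hL.exists_isCutoff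
  have htensor (n : ℕ) (j : Fin d) (t : Fin d → ℝ) :
      HasGeometricDerivs (n + 1) (4 * growthConst L * L n)
        fun s => tensorCutoff g (Function.update t j s) :=
    (hgR n).tensorCutoff_update (fun x => abs_le_one_of_mem_Icc (hg.mem_Icc x)) t j
  have hG01 := tensorCutoff_mem_Icc (ι := Fin d) hg.mem_Icc
  have hc := hg.isAdmissibleSecondKind_dyadicPiece (d := d)
  have hcmem : dyadicPiece (tensorCutoff g) ∈ smallDerivClass d L 1 (32 * growthConst L) :=
    mem_smallDerivClass_one hc.contDiffOn
      (fun t _ => abs_le_one_of_mem_Icc (dyadicPiece_mem_Icc hG01 t)) fun n j t _ =>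
      (HasGeometricDerivs.dyadicPiece_update (htensor n j) t).mono (by linarith)
  cases τ with
  | a =>
    have ha := hg.isAdmissibleSecondKind_tensorCutoff (d := d)
    exact ⟨tensorCutoff g, mem_smallDerivClass_one ha.contDiffOn
      (fun t _ => abs_le_one_of_mem_Icc (hG01 t)) fun n j t _ =>
      (htensor n j t).mono (by linarith [(htensor n j t).nonneg]), ha, fun t _ => hG01 t⟩
  | b => exact ⟨_, hcmem, hc.b_of_c, fun t _ => dyadicPiece_mem_Icc hG01 t⟩
  | c => exact ⟨_, hcmem, hc, fun t _ => dyadicPiece_mem_Icc hG01 t⟩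

theorem mainTheorem9 (d : ℕ) (hd : 1 ≤ d) (L : ℝ → ℝ) (hL : IsGrowthFunction L)
    (hconv : ConvexOn ℝ (Set.Ici 0) (fun t : ℝ => (t + 1) * Real.log (L t)))
    (τ : CutoffType) :
    ∃ A ∈ smallDerivClass d L 8
        (10 * (d : ℝ) * (2 * (d : ℝ) - 1) * growthConst L *
          (8 * ((d : ℝ) + 2) * growthConst L + 1)),
      IsAdmissibleSecondKind τ A ∧ ∀ t ∈ orthant d, 0 ≤ A t ∧ A t ≤ 1 := by
  obtain ⟨A, hA, hA'⟩ := mainTheorem9_general d L hL τ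
  have hM := hL.one_le_growthConst
  exact ⟨A, smallDerivClass_mono (fun t ht => zero_le_one.trans (hL.one_le t ht)) (by norm_num)
    (by positivity) (thirty_two_mul_le_of_one_le (Nat.one_le_cast.2 hd) hM) hA, hA'⟩
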